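/- Let $x_1,\dots,x_n\in\mathbb{R}^p$, $y_1,\dots,y_n\in\{-1,1\}$ and $\lambda>0$. Write $(a)_+=\max\{a,0\}$, $(a)_-=\max\{-a,0\}$, $(a)_\pm^2=((a)_\pm)^2$, and use the conventions $a^2/0=0$ if $a=0$, $a^2/0=+\infty$ if $a\neq 0$, and $0\cdot(+\infty)=0$. Let $$\Gamma=\Big\{\gamma\in\mathbb{R}^n:\ \gamma\ge 0,\ I-\sum_{i=1}^n\gamma_i x_ix_i^\top\succeq 0\Big\},$$ $$F(\gamma,w,z)=\|w\|_2^2+\lambda\sum_{i=1}^n z_i-\sum_{i=1}^n\gamma_i(1-y_ix_i^\top w)^2+\sum_{i=1}^n\gamma_i\left(\frac{(1-y_ix_i^\top w)_+^2}{z_i}+\frac{(1-y_ix_i^\top w)_-^2}{1-z_i}\right).$$ Then the max–min problem $$\max_{\gamma\in\Gamma}\ \min_{w\in\mathbb{R}^p,\ z\in[0,1]^n} F(\gamma,w,z)\qquad (\mathrm{P})$$ is equivalent to the SDP $$\min_{w\in\mathbb{R}^p,\ z\in\mathbb{R}^n,\ W\in\mathbb{R}^{p\times p}}\ \operatorname{tr}(W)+\lambda\sum_{i=1}^n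 z_i\qquad (\mathrm{S})$$ $$\text{s.t. } \langle x_ix_i^\top,W\rangle-2y_i(x_i^\top w)+1\ \ge\ \frac{(1-y_ix_i^\top w)_+^2}{z_i}+\frac{(1-y_ix_i^\top w)_-^2}{1-z_i}\quad (i=1,\dots,n),$$ $$\begin{pmatrix}1&w^\top\\ w&W\end{pmatrix}\succeq 0,\qquad z\in[0,1]^n,$$ in the following sense. The inner minimum in (P) is attained for every $\gamma\in\Gamma$, the outer maximum in (P) is attained, (S) has an optimal solution, and the optimal values of (P) and (S) are equal. Moreover, for all $\gamma\in\mathbb{R}^n$, $w\in\mathbb{R}^p$ and $z\in\mathbb{R}^n$, the triple $(\gamma,w,z)$ is a saddle point of (P) (that is, $\gamma\in\Gamma$, $z\in[0,1]^n$ and $F(\gamma',w,z)\le F(\gamma,w,z)\le F(\gamma,w',z')$ for all $\gamma'\in\Gamma$, $w'\in\mathbb{R}^p$, $z'\in[0,1]^n$) if and only if $\gamma$ attains the outer maximum in (P) and there is a $W$ such that $(w,z,W)$ is optimal for (S). In particular, the $(w,z)$-part of every optimal solution of (S) attains the inner minimum in (P) for every $\gamma$ that attains the outer maximum. -/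

import Mathlib

namespace ConicSVM

open scoped BigOperators Matrix

noncomputable section

/-- The extended-real quotient `a² / b` for `b ≥ 0`, with the convention
`a² / 0 = 0` if `a = 0` and `a² / 0 = +∞` otherwise. -/
def sqDiv (a b : ℝ) : EReal :=
  if b = 0 then (if a = 0 then 0 else ⊤) else ((a ^ 2 / b : ℝ) : EReal)

/-- The entrywise inner product `⟨A, B⟩ = ∑ i, ∑ j, A i j * B i j`. -/
def frobInner {p : ℕ} (A B : Matrix (Fin p) (Fin p) ℝ) : ℝ :=
  ∑ i, ∑ j, A i j * B i j

/-- The slack `1 - y xᵀw` of a labelled point `(x, y)`. -/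
def slack {p : ℕ} (x : Fin p → ℝ) (y : ℝ) (w : Fin p → ℝ) : ℝ :=
  1 - y * (x ⬝ᵥ w)

/-- `(1 - y xᵀw)₊² / z + (1 - y xᵀw)₋² / (1 - z)`, where `a⁺ = max a 0` and `a⁻ = max (-a) 0`. -/
def persp {p : ℕ} (x : Fin p → ℝ) (y : ℝ) (w : Fin p → ℝ) (z : ℝ) : EReal :=
  sqDiv (slack x y w)⁺ z + sqDiv (slack x y w)⁻ (1 - z)

/-- The box `[0,1]ⁿ`. -/
def box (n : ℕ) : Set (Fin n → ℝ) :=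
  {z | ∀ i, 0 ≤ z i ∧ z i ≤ 1}

/-- The multipliers `γ ≥ 0` with `I - ∑ γᵢ xᵢ xᵢᵀ ⪰ 0`. -/
def multipliers {n p : ℕ} (x : Fin n → Fin p → ℝ) : Set (Fin n → ℝ) :=
  {γ | (∀ i, 0 ≤ γ i) ∧
    ((1 : Matrix (Fin p) (Fin p) ℝ) - ∑ i, γ i • Matrix.vecMulVec (x i) (x i)).PosSemidef}

/-- The objective of the max-min problem. In `EReal` one has `0 * ⊤ = 0`, so a point with
`γᵢ = 0` contributes nothing to the last sum. -/
def objective {n p : ℕ} (x : Fin n → Fin p → ℝ) (y : Fin n → ℝ) (lam : ℝ)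
    (γ : Fin n → ℝ) (w : Fin p → ℝ) (z : Fin n → ℝ) : EReal :=
  (((∑ j, w j ^ 2) + lam * (∑ i, z i) - ∑ i, γ i * (slack (x i) (y i) w) ^ 2 : ℝ) : EReal)
    + ∑ i, (γ i : EReal) * persp (x i) (y i) w (z i)

/-- The optimal value of the inner minimization, as a function of `γ`. -/
def innerValue {n p : ℕ} (x : Fin n → Fin p → ℝ) (y : Fin n → ℝ) (lam : ℝ)
    (γ : Fin n → ℝ) : EReal :=
  ⨅ (w : Fin p → ℝ), ⨅ z ∈ box n, objective x y lam γ w z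

/-- The optimal value of the max-min problem. -/
def maxMinValue {n p : ℕ} (x : Fin n → Fin p → ℝ) (y : Fin n → ℝ) (lam : ℝ) : EReal :=
  ⨆ γ ∈ multipliers x, innerValue x y lam γ

/-- `(w, z)` attains the inner minimum for `γ`. -/
def IsInnerMin {n p : ℕ} (x : Fin n → Fin p → ℝ) (y : Fin n → ℝ) (lam : ℝ)
    (γ : Fin n → ℝ) (w : Fin p → ℝ) (z : Fin n → ℝ) : Prop :=
  z ∈ box n ∧ ∀ (w' : Fin p → ℝ), ∀ z' ∈ box n,
    objective x y lam γ w z ≤ objective x y lam γ w' z'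

/-- `γ` attains the outer maximum. -/
def IsOuterMax {n p : ℕ} (x : Fin n → Fin p → ℝ) (y : Fin n → ℝ) (lam : ℝ)
    (γ : Fin n → ℝ) : Prop :=
  γ ∈ multipliers x ∧ ∀ γ' ∈ multipliers x, innerValue x y lam γ' ≤ innerValue x y lam γ

/-- `(γ, (w, z))` is a saddle point of the max-min problem. -/
def IsSaddle {n p : ℕ} (x : Fin n → Fin p → ℝ) (y : Fin n → ℝ) (lam : ℝ)
    (γ : Fin n → ℝ) (w : Fin p → ℝ) (z : Fin n → ℝ) : Prop :=
  γ ∈ multipliers x ∧ IsInnerMin x y lam γ w z ∧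
    ∀ γ' ∈ multipliers x, objective x y lam γ' w z ≤ objective x y lam γ w z

/-- The feasible set of the SDP. -/
def SDPFeasible {n p : ℕ} (x : Fin n → Fin p → ℝ) (y : Fin n → ℝ)
    (w : Fin p → ℝ) (z : Fin n → ℝ) (W : Matrix (Fin p) (Fin p) ℝ) : Prop :=
  (∀ i, persp (x i) (y i) w (z i) ≤
    ((frobInner (Matrix.vecMulVec (x i) (x i)) W - 2 * y i * (x i ⬝ᵥ w) + 1 : ℝ) : EReal)) ∧
  (Matrix.fromBlocks (1 : Matrix Unit Unit ℝ) (Matrix.replicateRow Unit w)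
    (Matrix.replicateCol Unit w) W).PosSemidef ∧
  z ∈ box n

/-- The objective of the SDP. -/
def sdpObjective {n p : ℕ} (lam : ℝ) (z : Fin n → ℝ) (W : Matrix (Fin p) (Fin p) ℝ) : ℝ :=
  W.trace + lam * ∑ i, z i

/-- The optimal value of the SDP (`+∞` if infeasible, `-∞` if unbounded). -/
def sdpValue {n p : ℕ} (x : Fin n → Fin p → ℝ) (y : Fin n → ℝ) (lam : ℝ) : EReal :=
  ⨅ (w : Fin p → ℝ) (z : Fin n → ℝ) (W : Matrix (Fin p) (Fin p) ℝ)
    (_ : SDPFeasible x y w z W), (sdpObjective lam z W : EReal)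

/-- `(w, z, W)` is an optimal solution of the SDP. -/
def IsSDPMin {n p : ℕ} (x : Fin n → Fin p → ℝ) (y : Fin n → ℝ) (lam : ℝ)
    (w : Fin p → ℝ) (z : Fin n → ℝ) (W : Matrix (Fin p) (Fin p) ℝ) : Prop :=
  SDPFeasible x y w z W ∧ ∀ w' z' W', SDPFeasible x y w' z' W' →
    sdpObjective lam z W ≤ sdpObjective lam z' W'

end

end ConicSVM

/-!
The max-min problem is the Lagrangian dual of the semidefinite program. Dualizing the `n` scalar
constraints with multipliers `γ ≥ 0` leaves the minimization over `W ⪰ w wᵀ` of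
`tr ((I - ∑ i, γ i • x i (x i)ᵀ) W)`, which is bounded below exactly when
`I - ∑ i, γ i • x i (x i)ᵀ ⪰ 0`, and then `W = w wᵀ` is optimal; what remains is the objective of
the max-min problem.

Weak duality (`objective_le_sdpObjective`) is `tr (A B) ≥ 0` for positive semidefinite `A`, `B`.
Strong duality (`exists_multipliers_on`) comes from separating a convex set from a point
(`exists_lagrange_multipliers`), the perspective terms being convex because their epigraphs are
made of rotated second-order cones (`cone_convex`). A point with `x i = 0` violates Slater's
condition, but its constraint just says `z i = 1`; there the multiplier `lam` is large enough.

Strong duality is proved over an arbitrary convex set of pairs `(w, z)`. Taking all pairs gives an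
optimal `γ` and the equality of the two values (`exists_multipliers`). Taking a single pair gives,
for a saddle point, the matrix `W` that completes `(w, z)` to a solution of the semidefinite
program (`exists_sdp_min_of_forall_objective_le`).

Both minima are attained by compactness (`exists_min_of_cone`): the objectives dominate `‖w‖²`,
since a perspective term is at least the square of the slack, and substituting
`W = w wᵀ + Bᵀ B`, or a square for the excess of each perspective term, turns each problem into
the minimization of a coercive quadratic function over a closed set.
-/

namespace ConicSVM

open scoped Matrix
open Matrix

/-! ### The perspective term -/

/-- The condition under which the perspective term with slack `s` at `z ∈ [0, 1]` is finite. -/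
def Compat (s z : ℝ) : Prop := (z = 0 → s ≤ 0) ∧ (z = 1 → 0 ≤ s)

/-- The real value of the perspective term with slack `s` at `z`. Division by zero yields zero,
which is the intended value when `Compat s z` holds. -/
noncomputable def realPersp (s z : ℝ) : ℝ := s⁺ ^ 2 / z + s⁻ ^ 2 / (1 - z)

theorem persp_eq_coe {p : ℕ} (x : Fin p → ℝ) (y : ℝ) (w : Fin p → ℝ) {z : ℝ}
    (h : Compat (slack x y w) z) :
    persp x y w z = (realPersp (slack x y w) z : EReal) := by
  unfold persp sqDiv realPersp
  rw [EReal.coe_add]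
  congr 1
  · split_ifs with h0 h1
    · simp [h0]
    · exact absurd (posPart_eq_zero.2 (h.1 h0)) h1
    · rfl
  · split_ifs with h0 h1
    · simp [h0]
    · exact absurd (negPart_eq_zero.2 (h.2 (by linarith))) h1
    · rfl

theorem persp_eq_top {p : ℕ} (x : Fin p → ℝ) (y : ℝ) (w : Fin p → ℝ) {z : ℝ}
    (h : ¬ Compat (slack x y w) z) : persp x y w z = ⊤ := by
  have hb (a b : ℝ) : sqDiv a b ≠ ⊥ := by
    unfold sqDiv; split_ifs <;> simp [-EReal.coe_mul]
  unfold persp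
  by_cases h0 : z = 0 → slack x y w ≤ 0
  · have h1 : ¬ (z = 1 → 0 ≤ slack x y w) := fun h1 => h ⟨h0, h1⟩
    push Not at h1
    have : sqDiv (slack x y w)⁻ (1 - z) = ⊤ := by
      have h2 : (slack x y w)⁻ ≠ 0 := fun h2 => h1.2.not_ge (negPart_eq_zero.1 h2)
      simp [sqDiv, h1.1, h2]
    rw [this, EReal.add_top_of_ne_bot (hb _ _)]
  · push Not at h0
    have : sqDiv (slack x y w)⁺ z = ⊤ := by
      have h2 : (slack x y w)⁺ ≠ 0 := fun h2 => h0.2.not_ge (posPart_eq_zero.1 h2)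
      simp [sqDiv, h0.1, h2]
    rw [this, EReal.top_add_of_ne_bot (hb _ _)]

/-- The epigraph of the perspective term is cut out by two rotated second-order cones; the
division-free form is closed and convex in `(s, z, r)`. -/
theorem compat_and_realPersp_le_iff {s z r : ℝ} (hz : 0 ≤ z ∧ z ≤ 1) (hr : 0 ≤ r) :
    Compat s z ∧ realPersp s z ≤ r ↔ s⁺ ^ 2 ≤ r * z ∧ s⁻ ^ 2 ≤ r * (1 - z) := by
  unfold Compat realPersp
  rcases le_total 0 s with hs | hs
  · rw [posPart_eq_self.2 hs, negPart_eq_zero.2 hs]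
    have hz1 : 0 ≤ r * (1 - z) := mul_nonneg hr (by linarith [hz.2])
    rcases hz.1.eq_or_lt with rfl | hz0
    · constructor
      · rintro ⟨⟨h, -⟩, -⟩
        have : s = 0 := le_antisymm (h rfl) hs
        simp [this, hr]
      · rintro ⟨h, -⟩
        have : s = 0 := by nlinarith
        simp [this, hr]
    · rw [← div_le_iff₀ hz0]
      simp [hz0.ne', hs, hz1]
  · rw [posPart_eq_zero.2 hs, negPart_eq_neg.2 hs]
    have hz1 : 0 ≤ r * z := mul_nonneg hr hz.1
    rcases hz.2.eq_or_lt with rfl | hz0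
    · constructor
      · rintro ⟨⟨-, h⟩, -⟩
        have : s = 0 := le_antisymm hs (h rfl)
        simp [this, hr]
      · rintro ⟨-, h⟩
        have : s = 0 := by nlinarith
        simp [this, hr]
    · rw [← div_le_iff₀ (sub_pos.2 hz0)]
      simp [hz0.ne, hs, hz1]

theorem sq_le_of_cone {s z r : ℝ} (h : s⁺ ^ 2 ≤ r * z ∧ s⁻ ^ 2 ≤ r * (1 - z)) : s ^ 2 ≤ r := by
  have : s ^ 2 = s⁺ ^ 2 + s⁻ ^ 2 := by
    rcases le_total 0 s with hs | hs
    · rw [posPart_eq_self.2 hs, negPart_eq_zero.2 hs]; ring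
    · rw [posPart_eq_zero.2 hs, negPart_eq_neg.2 hs]; ring
  linarith [h.1, h.2]

theorem realPersp_nonneg {s z : ℝ} (hz : 0 ≤ z ∧ z ≤ 1) : 0 ≤ realPersp s z :=
  add_nonneg (div_nonneg (sq_nonneg _) hz.1) (div_nonneg (sq_nonneg _) (sub_nonneg.2 hz.2))

theorem Compat.cone {s z : ℝ} (hz : 0 ≤ z ∧ z ≤ 1) (h : Compat s z) :
    s⁺ ^ 2 ≤ realPersp s z * z ∧ s⁻ ^ 2 ≤ realPersp s z * (1 - z) :=
  (compat_and_realPersp_le_iff hz (realPersp_nonneg hz)).1 ⟨h, le_rfl⟩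

theorem Compat.sq_le {s z : ℝ} (hz : 0 ≤ z ∧ z ≤ 1) (h : Compat s z) : s ^ 2 ≤ realPersp s z :=
  sq_le_of_cone (h.cone hz)

theorem compat_of_mem_Ioo {s z : ℝ} (hz : 0 < z ∧ z < 1) : Compat s z :=
  ⟨fun h => absurd h hz.1.ne', fun h => absurd h hz.2.ne⟩

/-- Convexity of the rotated second-order cone `{(a, z, r) | a² ≤ r z}`. -/
theorem rotated_cone_convex {α β u v r r' z z' : ℝ} (hα : 0 ≤ α) (hβ : 0 ≤ β)
    (hr : 0 ≤ r) (hr' : 0 ≤ r') (hz : 0 ≤ z) (hz' : 0 ≤ z')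
    (h : u ^ 2 ≤ r * z) (h' : v ^ 2 ≤ r' * z') :
    (α * u + β * v) ^ 2 ≤ (α * r + β * r') * (α * z + β * z') := by
  have h1 : (u * v) ^ 2 ≤ (r * z) * (r' * z') := by
    rw [mul_pow]; exact mul_le_mul h h' (sq_nonneg _) (mul_nonneg hr hz)
  have h2 : 2 * (u * v) ≤ r * z' + r' * z := by
    refine le_of_sq_le_sq ?_ (by positivity)
    nlinarith [sq_nonneg (r * z' - r' * z)]
  nlinarith [mul_le_mul_of_nonneg_left h (sq_nonneg α), mul_le_mul_of_nonneg_left h' (sq_nonneg β),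
    mul_le_mul_of_nonneg_left h2 (mul_nonneg hα hβ)]

/-- Convexity of the epigraph of the perspective term. -/
theorem cone_convex {α β s s' r r' z z' : ℝ} (hα : 0 ≤ α) (hβ : 0 ≤ β) (hαβ : α + β = 1)
    (hr : 0 ≤ r) (hr' : 0 ≤ r') (hz : 0 ≤ z ∧ z ≤ 1) (hz' : 0 ≤ z' ∧ z' ≤ 1)
    (h : s⁺ ^ 2 ≤ r * z ∧ s⁻ ^ 2 ≤ r * (1 - z))
    (h' : s'⁺ ^ 2 ≤ r' * z' ∧ s'⁻ ^ 2 ≤ r' * (1 - z')) :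
    (α * s + β * s')⁺ ^ 2 ≤ (α * r + β * r') * (α * z + β * z') ∧
      (α * s + β * s')⁻ ^ 2 ≤ (α * r + β * r') * (1 - (α * z + β * z')) := by
  have e1 : 1 - (α * z + β * z') = α * (1 - z) + β * (1 - z') := by linear_combination -hαβ
  have p1 : (α * s + β * s')⁺ ≤ α * s⁺ + β * s'⁺ := by
    rw [posPart_def]
    refine sup_le ?_ (by positivity)
    gcongr <;> exact le_posPart _
  have p2 : (α * s + β * s')⁻ ≤ α * s⁻ + β * s'⁻ := by
    rw [negPart_def]
    refine sup_le ?_ (by positivity)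
    nlinarith [neg_le_negPart s, neg_le_negPart s', mul_le_mul_of_nonneg_left (neg_le_negPart s) hα,
      mul_le_mul_of_nonneg_left (neg_le_negPart s') hβ]
  rw [e1]
  exact ⟨(pow_le_pow_left₀ (posPart_nonneg _) p1 2).trans
      (rotated_cone_convex hα hβ hr hr' hz.1 hz'.1 h.1 h'.1),
    (pow_le_pow_left₀ (negPart_nonneg _) p2 2).trans
      (rotated_cone_convex hα hβ hr hr' (sub_nonneg.2 hz.2) (sub_nonneg.2 hz'.2) h.2 h'.2)⟩

/-! ### The objective of the max-min problem -/

/-- The objective of the max-min problem in real arithmetic; it agrees with `objective` where each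
`i` with `γ i ≠ 0` has a finite perspective term. -/
noncomputable def realObjective {n p : ℕ} (x : Fin n → Fin p → ℝ) (y : Fin n → ℝ) (lam : ℝ)
    (γ : Fin n → ℝ) (w : Fin p → ℝ) (z : Fin n → ℝ) : ℝ :=
  ∑ j, w j ^ 2 + lam * ∑ i, z i +
    ∑ i, γ i * (realPersp (slack (x i) (y i) w) (z i) - slack (x i) (y i) w ^ 2)

theorem coe_finset_sum {ι : Type*} (t : Finset ι) (f : ι → ℝ) :
    ((∑ i ∈ t, f i : ℝ) : EReal) = ∑ i ∈ t, (f i : EReal) :=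
  map_sum (⟨⟨(↑), EReal.coe_zero⟩, EReal.coe_add⟩ : ℝ →+ EReal) f t

theorem objective_eq_coe {n p : ℕ} {x : Fin n → Fin p → ℝ} {y : Fin n → ℝ} {lam : ℝ}
    {γ : Fin n → ℝ} {w : Fin p → ℝ} {z : Fin n → ℝ}
    (h : ∀ i, γ i ≠ 0 → Compat (slack (x i) (y i) w) (z i)) :
    objective x y lam γ w z = (realObjective x y lam γ w z : EReal) := by
  have h1 (i) : (γ i : EReal) * persp (x i) (y i) w (z i) =
      ((γ i * realPersp (slack (x i) (y i) w) (z i) : ℝ) : EReal) := by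
    by_cases h0 : γ i = 0
    · simp [h0]
    · rw [persp_eq_coe _ _ _ (h i h0), EReal.coe_mul]
  unfold objective realObjective
  simp_rw [h1]
  rw [← coe_finset_sum, ← EReal.coe_add]
  congr 1
  simp only [mul_sub, Finset.sum_sub_distrib]
  ring

theorem persp_nonneg {p : ℕ} (x : Fin p → ℝ) (y : ℝ) (w : Fin p → ℝ) {z : ℝ}
    (hz : 0 ≤ z ∧ z ≤ 1) : 0 ≤ persp x y w z := by
  by_cases h : Compat (slack x y w) z
  · rw [persp_eq_coe _ _ _ h]
    exact_mod_cast realPersp_nonneg hz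
  · rw [persp_eq_top _ _ _ h]; exact le_top

theorem objective_eq_top {n p : ℕ} {x : Fin n → Fin p → ℝ} {y : Fin n → ℝ} {lam : ℝ}
    {γ : Fin n → ℝ} {w : Fin p → ℝ} {z : Fin n → ℝ} (hγ : ∀ i, 0 ≤ γ i) (hz : z ∈ box n)
    {i : Fin n} (hi : γ i ≠ 0) (h : ¬ Compat (slack (x i) (y i) w) (z i)) :
    objective x y lam γ w z = ⊤ := by
  unfold objective
  have h1 : (γ i : EReal) * persp (x i) (y i) w (z i) = ⊤ := by
    rw [persp_eq_top _ _ _ h, EReal.coe_mul_top_of_pos ((hγ i).lt_of_ne' hi)]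
  have h2 : ∑ i, (γ i : EReal) * persp (x i) (y i) w (z i) = ⊤ := by
    refine top_le_iff.1 (h1 ▸ ?_)
    exact Finset.single_le_sum (f := fun i => (γ i : EReal) * persp (x i) (y i) w (z i))
      (fun j _ => mul_nonneg (by exact_mod_cast hγ j) (persp_nonneg _ _ _ (hz j)))
      (Finset.mem_univ i)
  rw [h2, EReal.coe_add_top]

/-! ### Quadratic forms and positive semidefinite matrices -/

theorem mem_multipliers_iff {n p : ℕ} {x : Fin n → Fin p → ℝ} {γ : Fin n → ℝ} :
    γ ∈ multipliers x ↔ (∀ i, 0 ≤ γ i) ∧ ∀ u, ∑ i, γ i * (x i ⬝ᵥ u) ^ 2 ≤ u ⬝ᵥ u := by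
  have key (u : Fin p → ℝ) : u ⬝ᵥ ((1 - ∑ i, γ i • vecMulVec (x i) (x i)) *ᵥ u) =
      u ⬝ᵥ u - ∑ i, γ i * (x i ⬝ᵥ u) ^ 2 := by
    rw [sub_mulVec, one_mulVec, dotProduct_sub, sum_mulVec, dotProduct_sum]
    congr 1
    refine Finset.sum_congr rfl fun i _ => ?_
    rw [smul_mulVec, dotProduct_smul, vecMulVec_mulVec, op_smul_eq_smul, dotProduct_smul,
      dotProduct_comm u (x i), smul_eq_mul, smul_eq_mul, sq]
  have herm : (1 - ∑ i, γ i • vecMulVec (x i) (x i)).IsHermitian := by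
    refine isHermitian_one.sub ?_
    rw [IsHermitian, conjTranspose_eq_transpose_of_trivial, transpose_sum]
    simp
  refine and_congr_right fun _ => ⟨fun h u => ?_, fun h => ?_⟩
  · have := h.dotProduct_mulVec_nonneg u
    rw [star_trivial, key] at this
    linarith
  · refine .of_dotProduct_mulVec_nonneg herm fun u => ?_
    rw [star_trivial, key]
    linarith [h u]

theorem frobInner_vecMulVec {p : ℕ} (u : Fin p → ℝ) (W : Matrix (Fin p) (Fin p) ℝ) :
    frobInner (vecMulVec u u) W = u ⬝ᵥ W *ᵥ u := by
  simp only [frobInner, vecMulVec_apply, dotProduct, mulVec, Finset.mul_sum]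
  refine Finset.sum_congr rfl fun i _ => Finset.sum_congr rfl fun j _ => by ring

theorem trace_vecMulVec_self {p : ℕ} (w : Fin p → ℝ) :
    (vecMulVec w w).trace = ∑ j, w j ^ 2 := by
  simp [trace, vecMulVec_apply, sq]

theorem dotProduct_vecMulVec_mulVec {p : ℕ} (u w : Fin p → ℝ) :
    u ⬝ᵥ vecMulVec w w *ᵥ u = (u ⬝ᵥ w) ^ 2 := by
  rw [vecMulVec_mulVec, op_smul_eq_smul, dotProduct_smul, dotProduct_comm w u, smul_eq_mul, sq]

/-- The Schur complement form of the linear matrix inequality. -/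
theorem posSemidef_fromBlocks_iff {p : ℕ} (w : Fin p → ℝ) (W : Matrix (Fin p) (Fin p) ℝ) :
    (fromBlocks (1 : Matrix Unit Unit ℝ) (replicateRow Unit w)
      (replicateCol Unit w) W).PosSemidef ↔ (W - vecMulVec w w).PosSemidef := by
  let : Invertible (1 : Matrix Unit Unit ℝ) := invertibleOne
  have := PosDef.fromBlocks₁₁ (replicateRow Unit w) W (PosDef.one (n := Unit) (R := ℝ))
  rw [conjTranspose_replicateRow, star_trivial] at this
  rw [this, inv_one, Matrix.mul_one, ← vecMulVec_eq]

theorem exists_eq_transpose_mul_self {p : ℕ} {V : Matrix (Fin p) (Fin p) ℝ} (hV : V.PosSemidef) :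
    ∃ B : Matrix (Fin p) (Fin p) ℝ, V = Bᵀ * B := by
  open scoped MatrixOrder in
  open scoped Matrix.Norms.L2Operator in
  obtain ⟨B, hB⟩ := CStarAlgebra.nonneg_iff_eq_star_mul_self.1 (nonneg_iff_posSemidef.2 hV)
  exact ⟨B, by rw [hB, star_eq_conjTranspose, conjTranspose_eq_transpose_of_trivial]⟩

theorem posSemidef_transpose_mul_self {p : ℕ} (B : Matrix (Fin p) (Fin p) ℝ) :
    (Bᵀ * B).PosSemidef := by
  have := posSemidef_conjTranspose_mul_self B
  rwa [conjTranspose_eq_transpose_of_trivial] at this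

theorem dotProduct_transpose_mul_self_mulVec {p : ℕ} (B : Matrix (Fin p) (Fin p) ℝ)
    (u : Fin p → ℝ) :
    u ⬝ᵥ (Bᵀ * B) *ᵥ u = (B *ᵥ u) ⬝ᵥ (B *ᵥ u) := by
  rw [← mulVec_mulVec, dotProduct_mulVec, vecMul_transpose]

theorem trace_transpose_mul_self {p : ℕ} (B : Matrix (Fin p) (Fin p) ℝ) :
    (Bᵀ * B).trace = ∑ k, B k ⬝ᵥ B k := by
  rw [trace_mul_comm]
  simp [trace, mul_apply, dotProduct]

/-- With `V = Bᵀ B`, this is the defining inequality of `multipliers x` summed over the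
rows of `B`. -/
theorem mem_multipliers_sum_le_trace {n p : ℕ} {x : Fin n → Fin p → ℝ} {γ : Fin n → ℝ}
    (hγ : γ ∈ multipliers x) {V : Matrix (Fin p) (Fin p) ℝ} (hV : V.PosSemidef) :
    ∑ i, γ i * (x i ⬝ᵥ V *ᵥ x i) ≤ V.trace := by
  obtain ⟨B, rfl⟩ := exists_eq_transpose_mul_self hV
  simp_rw [dotProduct_transpose_mul_self_mulVec, trace_transpose_mul_self]
  have h1 (i) : γ i * ((B *ᵥ x i) ⬝ᵥ (B *ᵥ x i)) = ∑ k, γ i * (x i ⬝ᵥ B k) ^ 2 := by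
    rw [← Finset.mul_sum]
    congr 1
    exact Finset.sum_congr rfl fun k _ => by rw [mulVec, dotProduct_comm, sq]
  simp_rw [h1]
  rw [Finset.sum_comm]
  exact Finset.sum_le_sum fun k _ => (mem_multipliers_iff.1 hγ).2 (B k)

/-! ### Feasibility and weak duality -/

/-- Feasibility in real arithmetic, expressed through `W - w wᵀ`. As `y i ^ 2 = 1`, the bound
on the perspective term is `slack ^ 2 + (x i)ᵀ (W - w wᵀ) (x i)`. -/
theorem SDPFeasible_iff {n p : ℕ} {x : Fin n → Fin p → ℝ} {y : Fin n → ℝ}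
    (hy : ∀ i, y i = 1 ∨ y i = -1) {w : Fin p → ℝ} {z : Fin n → ℝ}
    {W : Matrix (Fin p) (Fin p) ℝ} :
    SDPFeasible x y w z W ↔ z ∈ box n ∧ (W - vecMulVec w w).PosSemidef ∧
      ∀ i, Compat (slack (x i) (y i) w) (z i) ∧ realPersp (slack (x i) (y i) w) (z i) ≤
        slack (x i) (y i) w ^ 2 + x i ⬝ᵥ (W - vecMulVec w w) *ᵥ x i := by
  unfold SDPFeasible
  rw [posSemidef_fromBlocks_iff, and_comm, and_assoc, and_left_comm]
  refine and_congr_right fun _ => and_congr_right fun _ => forall_congr' fun i => ?_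
  have e : frobInner (vecMulVec (x i) (x i)) W - 2 * y i * (x i ⬝ᵥ w) + 1 =
      slack (x i) (y i) w ^ 2 + x i ⬝ᵥ (W - vecMulVec w w) *ᵥ x i := by
    rw [frobInner_vecMulVec, sub_mulVec, dotProduct_sub, dotProduct_vecMulVec_mulVec, slack]
    have : y i ^ 2 = 1 := by rcases hy i with h | h <;> simp [h]
    linear_combination (-(x i ⬝ᵥ w) ^ 2) * this
  rw [e]
  by_cases h : Compat (slack (x i) (y i) w) (z i)
  · rw [persp_eq_coe _ _ _ h, EReal.coe_le_coe_iff]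
    simp [h]
  · rw [persp_eq_top _ _ _ h]
    simp only [h, false_and, iff_false, top_le_iff]
    exact EReal.coe_ne_top _

/-- Weak duality: summing the constraints with weights `γ i` gives
`∑ i, γ i * (x i)ᵀ (W - w wᵀ) (x i)`, at most `tr (W - w wᵀ)`. -/
theorem objective_le_sdpObjective {n p : ℕ} {x : Fin n → Fin p → ℝ} {y : Fin n → ℝ}
    (hy : ∀ i, y i = 1 ∨ y i = -1) (lam : ℝ) {γ : Fin n → ℝ} (hγ : γ ∈ multipliers x)
    {w : Fin p → ℝ} {z : Fin n → ℝ} {W : Matrix (Fin p) (Fin p) ℝ}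
    (h : SDPFeasible x y w z W) :
    objective x y lam γ w z ≤ (sdpObjective lam z W : EReal) := by
  obtain ⟨-, hW, hc⟩ := (SDPFeasible_iff hy).1 h
  rw [objective_eq_coe fun i _ => (hc i).1, EReal.coe_le_coe_iff]
  have h1 := mem_multipliers_sum_le_trace hγ hW
  have h2 : ∑ i, γ i * (realPersp (slack (x i) (y i) w) (z i) - slack (x i) (y i) w ^ 2) ≤
      ∑ i, γ i * (x i ⬝ᵥ (W - vecMulVec w w) *ᵥ x i) :=
    Finset.sum_le_sum fun i _ =>
      mul_le_mul_of_nonneg_left (by linarith [(hc i).2]) (hγ.1 i)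
  rw [trace_sub, trace_vecMulVec_self] at h1
  unfold realObjective sdpObjective
  linarith

theorem smul_single_mem_multipliers {n p : ℕ} (x : Fin n → Fin p → ℝ) (i : Fin n) {t : ℝ}
    (ht : 0 ≤ t) (h : t * (x i ⬝ᵥ x i) ≤ 1) : Pi.single i t ∈ multipliers x := by
  refine mem_multipliers_iff.2 ⟨fun j => ?_, fun u => ?_⟩
  · rcases eq_or_ne j i with rfl | hj
    · simpa using ht
    · simp [hj]
  · rw [Finset.sum_eq_single i (fun j _ hj => by simp [hj]) (by simp), Pi.single_eq_same]
    have cs : (x i ⬝ᵥ u) ^ 2 ≤ (x i ⬝ᵥ x i) * (u ⬝ᵥ u) := by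
      simpa only [dotProduct, sq] using
        Finset.sum_mul_sq_le_sq_mul_sq Finset.univ (x i) u
    have hu : 0 ≤ u ⬝ᵥ u := Finset.sum_nonneg fun j _ => mul_self_nonneg _
    nlinarith [mul_le_mul_of_nonneg_left cs ht]

/-! ### Lagrange multipliers -/

theorem nonneg_of_forall_le_add_mul {a b k : ℝ} (h : ∀ t, 0 ≤ t → k ≤ a + b * t) : 0 ≤ b := by
  by_contra hb
  push Not at hb
  have h1 := h ((|a - k| + 1) / (-b)) (div_nonneg (by positivity) (by linarith))
  have h2 : b * ((|a - k| + 1) / (-b)) = -(|a - k| + 1) := by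
    have : b ≠ 0 := hb.ne
    field_simp
  linarith [le_abs_self (a - k)]

/-- Lagrange multipliers for a convex program satisfying Slater's condition. No topology on `E` is
needed: the separation takes place in the space of constraint and objective values. -/
theorem exists_lagrange_multipliers {E : Type*} [AddCommGroup E] [Module ℝ E] {n : ℕ}
    {K : Set E} {f : E → ℝ} {g : Fin n → E → ℝ} (hf : ConvexOn ℝ K f)
    (hg : ∀ i, ConvexOn ℝ K (g i)) {e₀ : E} (he₀ : e₀ ∈ K) (hs : ∀ i, g i e₀ < 0) {v : ℝ}
    (hv : ∀ e ∈ K, (∀ i, g i e ≤ 0) → v ≤ f e) :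
    ∃ γ : Fin n → ℝ, (∀ i, 0 ≤ γ i) ∧ ∀ e ∈ K, v ≤ f e + ∑ i, γ i * g i e := by
  classical
  let A : Set ((Fin n → ℝ) × ℝ) := {q | ∃ e ∈ K, (∀ i, g i e < q.1 i) ∧ f e < q.2}
  have hA : Convex ℝ A := by
    rintro ⟨u, t⟩ ⟨e, he, hu, ht⟩ ⟨u', t'⟩ ⟨e', he', hu', ht'⟩ a b ha hb hab
    have conv {c d c' d' : ℝ} (h : c < d) (h' : c' < d') : a * c + b * c' < a * d + b * d' := by
      rcases ha.eq_or_lt with rfl | ha0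
      · obtain rfl : b = 1 := by linarith
        linarith
      · linarith [mul_lt_mul_of_pos_left h ha0, mul_le_mul_of_nonneg_left h'.le hb]
    refine ⟨a • e + b • e', hf.1 he he' ha hb hab, fun i => ?_, ?_⟩
    · exact ((hg i).2 he he' ha hb hab).trans_lt (conv (hu i) (hu' i))
    · exact (hf.2 he he' ha hb hab).trans_lt (conv ht ht')
  have hAo : IsOpen A := by
    have : A = ⋃ e ∈ K, ((⋂ i, {q : (Fin n → ℝ) × ℝ | g i e < q.1 i}) ∩ {q | f e < q.2}) := by
      ext q; simp [A, and_left_comm]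
    rw [this]
    refine isOpen_biUnion fun e _ => IsOpen.inter (isOpen_iInter_of_finite fun i => ?_) ?_
    · exact isOpen_lt continuous_const (by fun_prop)
    · exact isOpen_lt continuous_const (by fun_prop)
  have h0 : ((0 : Fin n → ℝ), v) ∉ A := by
    rintro ⟨e, he, h1, h2⟩
    exact (hv e he fun i => (h1 i).le).not_gt h2
  obtain ⟨l, hl⟩ := geometric_hahn_banach_open_point hA hAo h0
  -- The separating functional is `(u, t) ↦ -∑ i, c i * u i - d * t` with `c, d ≥ 0`.
  let c : Fin n → ℝ := fun i => -l (Pi.single i 1, 0)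
  let d : ℝ := -l (0, 1)
  have hlin (u : Fin n → ℝ) (t : ℝ) : l (u, t) = -∑ i, c i * u i - d * t := by
    have e : (u, t) = ∑ i, u i • ((Pi.single i 1 : Fin n → ℝ), (0 : ℝ)) +
        t • ((0 : Fin n → ℝ), (1 : ℝ)) := by
      refine Prod.ext ?_ ?_
      · funext j
        simp [Prod.fst_sum, Finset.sum_apply, Pi.single_apply]
      · simp [Prod.snd_sum]
    rw [e, map_add, map_sum]
    simp only [map_smul, smul_eq_mul, c, d]
    simp only [mul_neg, Finset.sum_neg_distrib, neg_neg, sub_neg_eq_add, mul_comm]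
  have hlow (u : Fin n → ℝ) (t : ℝ) (h : (u, t) ∈ A) : d * v < ∑ i, c i * u i + d * t := by
    have := hl _ h
    rw [hlin, hlin] at this
    simp at this
    linarith
  have hup : ∀ e ∈ K, d * v ≤ ∑ i, c i * g i e + d * f e := by
    intro e he
    refine le_of_forall_pos_le_add fun ε hε => ?_
    set S := |∑ i, c i + d| + 1 with hS
    have hSp : 0 < S := by positivity
    have := hlow (fun i => g i e + ε / S) (f e + ε / S)
      ⟨e, he, fun i => lt_add_of_pos_right _ (by positivity), lt_add_of_pos_right _ (by positivity)⟩
    have e2 : ∑ i, c i * (g i e + ε / S) + d * (f e + ε / S) =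
        ∑ i, c i * g i e + d * f e + (∑ i, c i + d) * (ε / S) := by
      simp only [mul_add, Finset.sum_add_distrib, ← Finset.sum_mul]
      ring
    have e3 : (∑ i, c i + d) * (ε / S) ≤ ε := by
      calc _ ≤ S * (ε / S) := by
            gcongr; rw [hS]; linarith [le_abs_self (∑ i, c i + d)]
        _ = ε := by field_simp
    linarith
  have hc (i) : 0 ≤ c i := by
    refine nonneg_of_forall_le_add_mul (k := d * v) (a := d * (f e₀ + 1)) fun t ht => ?_
    have := hlow (Pi.single i t) (f e₀ + 1) ⟨e₀, he₀, fun j => (hs j).trans_le ?_, lt_add_one _⟩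
    · rw [Finset.sum_eq_single i (fun j _ hj => by simp [hj]) (by simp), Pi.single_eq_same] at this
      linarith
    · rcases eq_or_ne j i with rfl | hj
      · simpa using ht
      · simp [hj]
  have hd0 : 0 ≤ d := by
    refine nonneg_of_forall_le_add_mul (k := d * v) (a := d * (f e₀ + 1)) fun t ht => ?_
    have := hlow 0 (f e₀ + 1 + t) ⟨e₀, he₀, fun j => hs j, by simp only; linarith⟩
    simp at this
    linarith
  -- At the Slater point all `g i` are negative, so `(0, t) ∈ A` for large `t`.
  have hd : 0 < d := by
    refine hd0.lt_of_ne' fun hd => ?_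
    have h3 := hlow 0 (f e₀ + 1) ⟨e₀, he₀, fun j => hs j, lt_add_one _⟩
    simp [hd] at h3
  refine ⟨fun i => c i / d, fun i => div_nonneg (hc i) hd0, fun e he => ?_⟩
  have h1 := hup e he
  have h2 : ∑ i, c i / d * g i e = (∑ i, c i * g i e) / d := by
    rw [Finset.sum_div]; exact Finset.sum_congr rfl fun i _ => by ring
  rw [h2, ← sub_le_iff_le_add', le_div_iff₀ hd]
  linarith

/-! ### Attainment -/

/-- A common form of the inner problem and the semidefinite program. The variable `b` enters the
objective through `∑ k, b k ^ 2` and relaxes the scaled cone constraints through `q`. -/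
theorem exists_min_of_cone {ι : Type*} [Fintype ι] {n p : ℕ} (x : Fin n → Fin p → ℝ)
    (y : Fin n → ℝ) {lam : ℝ} (hlam : 0 ≤ lam) (c : Fin n → ℝ) {q : Fin n → (ι → ℝ) → ℝ}
    (hq : ∀ i, Continuous (q i)) {C : Set ((Fin p → ℝ) × (Fin n → ℝ))} (hC : IsClosed C)
    {S : Set ((Fin p → ℝ) × (Fin n → ℝ) × (ι → ℝ))}
    (hS : ∀ w z b, (w, z, b) ∈ S ↔ (w, z) ∈ C ∧ z ∈ box n ∧ ∀ i,
      c i * (slack (x i) (y i) w)⁺ ^ 2 ≤ (c i * slack (x i) (y i) w ^ 2 + q i b) * z i ∧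
      c i * (slack (x i) (y i) w)⁻ ^ 2 ≤ (c i * slack (x i) (y i) w ^ 2 + q i b) * (1 - z i))
    (hne : S.Nonempty) :
    ∃ w z b, (w, z, b) ∈ S ∧ ∀ w' z' b', (w', z', b') ∈ S →
      ∑ j, w j ^ 2 + lam * ∑ i, z i + ∑ k, b k ^ 2 ≤
        ∑ j, w' j ^ 2 + lam * ∑ i, z' i + ∑ k, b' k ^ 2 := by
  let f : (Fin p → ℝ) × (Fin n → ℝ) × (ι → ℝ) → ℝ :=
    fun e => ∑ j, e.1 j ^ 2 + lam * ∑ i, e.2.1 i + ∑ k, e.2.2 k ^ 2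
  have hf : Continuous f := by fun_prop
  have hslack (i) : Continuous fun e : (Fin p → ℝ) × (Fin n → ℝ) × (ι → ℝ) =>
      slack (x i) (y i) e.1 := by unfold slack dotProduct; fun_prop
  have hSc : IsClosed S := by
    have : S = {e | (e.1, e.2.1) ∈ C} ∩ ((⋂ i, {e | 0 ≤ e.2.1 i} ∩ {e | e.2.1 i ≤ 1}) ∩
        ⋂ i, {e | c i * (slack (x i) (y i) e.1)⁺ ^ 2 ≤
            (c i * slack (x i) (y i) e.1 ^ 2 + q i e.2.2) * e.2.1 i} ∩
          {e | c i * (slack (x i) (y i) e.1)⁻ ^ 2 ≤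
            (c i * slack (x i) (y i) e.1 ^ 2 + q i e.2.2) * (1 - e.2.1 i)}) := by
      ext ⟨w, z, b⟩
      rw [hS]
      simp [box]
    rw [this]
    have hpos (i) : Continuous fun e : (Fin p → ℝ) × (Fin n → ℝ) × (ι → ℝ) =>
        (slack (x i) (y i) e.1)⁺ := (hslack i).sup continuous_const
    have hneg (i) : Continuous fun e : (Fin p → ℝ) × (Fin n → ℝ) × (ι → ℝ) =>
        (slack (x i) (y i) e.1)⁻ := (hslack i).neg.sup continuous_const
    refine (hC.preimage (by fun_prop)).inter (.inter (isClosed_iInter fun i => .inter ?_ ?_)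
      (isClosed_iInter fun i => .inter ?_ ?_))
    all_goals
      have := hpos i
      have := hneg i
      have := hslack i
      have := hq i
      refine isClosed_le ?_ ?_ <;> fun_prop
  obtain ⟨e₀, he₀⟩ := hne
  set M := f e₀
  have hK : IsCompact (S ∩ {e | f e ≤ M}) := by
    refine (isCompact_Icc (a := ((fun _ => -(M + 1), fun _ => 0, fun _ => -(M + 1)) :
      (Fin p → ℝ) × (Fin n → ℝ) × (ι → ℝ))) (b := (fun _ => M + 1, fun _ => 1, fun _ => M + 1))
      ).of_isClosed_subset (hSc.inter (isClosed_le hf continuous_const)) ?_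
    rintro ⟨w, z, b⟩ ⟨he, hM⟩
    have hz := ((hS w z b).1 he).2.1
    have h1 : 0 ≤ lam * ∑ i, z i := mul_nonneg hlam (Finset.sum_nonneg fun i _ => (hz i).1)
    have h2 : 0 ≤ ∑ j, w j ^ 2 := Finset.sum_nonneg fun i _ => sq_nonneg _
    have h3 : 0 ≤ ∑ k, b k ^ 2 := Finset.sum_nonneg fun i _ => sq_nonneg _
    change ∑ j, w j ^ 2 + lam * ∑ i, z i + ∑ k, b k ^ 2 ≤ M at hM
    have bound {a : ℝ} (ha : a ^ 2 ≤ M) : -(M + 1) ≤ a ∧ a ≤ M + 1 := by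
      constructor <;> nlinarith [sq_nonneg (a - 1), sq_nonneg (a + 1)]
    have hw (j) : -(M + 1) ≤ w j ∧ w j ≤ M + 1 := by
      have := Finset.single_le_sum (f := fun j => w j ^ 2) (fun j _ => sq_nonneg _)
        (Finset.mem_univ j)
      exact bound (by linarith)
    have hb (j) : -(M + 1) ≤ b j ∧ b j ≤ M + 1 := by
      have := Finset.single_le_sum (f := fun j => b j ^ 2) (fun j _ => sq_nonneg _)
        (Finset.mem_univ j)
      exact bound (by linarith)
    exact ⟨⟨fun j => (hw j).1, fun i => (hz i).1, fun k => (hb k).1⟩,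
      ⟨fun j => (hw j).2, fun i => (hz i).2, fun k => (hb k).2⟩⟩
  obtain ⟨⟨w, z, b⟩, hm, hmin⟩ := hK.exists_isMinOn ⟨e₀, he₀, le_refl M⟩ hf.continuousOn
  refine ⟨w, z, b, hm.1, fun w' z' b' h' => ?_⟩
  by_cases h : f (w', z', b') ≤ M
  · exact hmin ⟨h', h⟩
  · exact hm.2.trans (le_of_not_ge h)

/-- The semidefinite program restricted to a closed set of pairs `(w, z)` attains its minimum. -/
theorem exists_sdp_min_on {n p : ℕ} (x : Fin n → Fin p → ℝ) {y : Fin n → ℝ}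
    (hy : ∀ i, y i = 1 ∨ y i = -1) {lam : ℝ} (hlam : 0 ≤ lam)
    {C : Set ((Fin p → ℝ) × (Fin n → ℝ))} (hC : IsClosed C)
    (hne : ∃ w z W, (w, z) ∈ C ∧ SDPFeasible x y w z W) :
    ∃ w z W, (w, z) ∈ C ∧ SDPFeasible x y w z W ∧ ∀ w' z' W', (w', z') ∈ C →
      SDPFeasible x y w' z' W' → sdpObjective lam z W ≤ sdpObjective lam z' W' := by
  -- The variable `b` holds the entries of a factor `B` with `W = w wᵀ + Bᵀ B`.
  let Q (i : Fin n) (b : Fin p × Fin p → ℝ) : ℝ :=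
    ((of fun k l => b (k, l)) *ᵥ x i) ⬝ᵥ ((of fun k l => b (k, l)) *ᵥ x i)
  have hQ (i) : Continuous (Q i) := by
    unfold Q
    simp only [dotProduct, mulVec, of_apply]
    fun_prop
  let S : Set ((Fin p → ℝ) × (Fin n → ℝ) × (Fin p × Fin p → ℝ)) :=
    {e | (e.1, e.2.1) ∈ C ∧ e.2.1 ∈ box n ∧ ∀ i,
      1 * (slack (x i) (y i) e.1)⁺ ^ 2 ≤
        (1 * slack (x i) (y i) e.1 ^ 2 + Q i e.2.2) * e.2.1 i ∧
      1 * (slack (x i) (y i) e.1)⁻ ^ 2 ≤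
        (1 * slack (x i) (y i) e.1 ^ 2 + Q i e.2.2) * (1 - e.2.1 i)}
  have hQ0 (i b) : 0 ≤ Q i b := Finset.sum_nonneg fun _ _ => mul_self_nonneg _
  have hS (w z) (b : Fin p × Fin p → ℝ) : (w, z, b) ∈ S ↔ (w, z) ∈ C ∧
      SDPFeasible x y w z (vecMulVec w w + (of fun k l => b (k, l))ᵀ * of fun k l => b (k, l)) := by
    rw [SDPFeasible_iff hy]
    simp only [S, Set.mem_ofPred_eq, add_sub_cancel_left, posSemidef_transpose_mul_self, true_and,
      dotProduct_transpose_mul_self_mulVec, one_mul]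
    refine and_congr_right fun _ => and_congr_right fun hz => forall_congr' fun i => ?_
    exact (compat_and_realPersp_le_iff (hz i) (add_nonneg (sq_nonneg _) (hQ0 i b))).symm
  have hobj (w) (z : Fin n → ℝ) (b : Fin p × Fin p → ℝ) : sdpObjective lam z
      (vecMulVec w w + (of fun k l => b (k, l))ᵀ * of fun k l => b (k, l)) =
      ∑ j, w j ^ 2 + lam * ∑ i, z i + ∑ k, b k ^ 2 := by
    rw [sdpObjective, trace_add, trace_vecMulVec_self, trace_transpose_mul_self,
      Fintype.sum_prod_type]
    simp only [dotProduct, of_apply, ← sq]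
    ring
  have hex {w z W} (h : SDPFeasible x y w z W) : ∃ b : Fin p × Fin p → ℝ,
      W = vecMulVec w w + (of fun k l => b (k, l))ᵀ * of fun k l => b (k, l) := by
    obtain ⟨B, hB⟩ := exists_eq_transpose_mul_self ((SDPFeasible_iff hy).1 h).2.1
    exact ⟨fun k => B k.1 k.2, by rw [← sub_eq_iff_eq_add', hB]; rfl⟩
  obtain ⟨w₀, z₀, W₀, h₀, hf₀⟩ := hne
  obtain ⟨b₀, rfl⟩ := hex hf₀
  obtain ⟨w, z, b, hm, hmin⟩ := exists_min_of_cone x y hlam (fun _ => 1) hQ hC (S := S)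
    (fun _ _ _ => Iff.rfl) ⟨(w₀, z₀, b₀), (hS _ _ _).2 ⟨h₀, hf₀⟩⟩
  refine ⟨w, z, _, ((hS w z b).1 hm).1, ((hS w z b).1 hm).2, fun w' z' W' hC' hf' => ?_⟩
  obtain ⟨b', rfl⟩ := hex hf'
  rw [hobj, hobj]
  exact hmin w' z' b' ((hS _ _ _).2 ⟨hC', hf'⟩)

theorem one_mem_box (n : ℕ) : (1 : Fin n → ℝ) ∈ box n := fun i => by simp

/-- The inner minimum is attained, even where `I - ∑ i, γ i • x i (x i)ᵀ` is singular. -/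
theorem exists_isInnerMin {n p : ℕ} (x : Fin n → Fin p → ℝ) (y : Fin n → ℝ) {lam : ℝ}
    (hlam : 0 ≤ lam) {γ : Fin n → ℝ} (hγ : ∀ i, 0 ≤ γ i) : ∃ w z, IsInnerMin x y lam γ w z := by
  -- The variable `b i` satisfies `b i ^ 2 ≥ γ i * (realPersp s (z i) - s ^ 2)`.
  let S : Set ((Fin p → ℝ) × (Fin n → ℝ) × (Fin n → ℝ)) :=
    {e | (e.1, e.2.1) ∈ Set.univ ∧ e.2.1 ∈ box n ∧ ∀ i,
      γ i * (slack (x i) (y i) e.1)⁺ ^ 2 ≤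
        (γ i * slack (x i) (y i) e.1 ^ 2 + e.2.2 i ^ 2) * e.2.1 i ∧
      γ i * (slack (x i) (y i) e.1)⁻ ^ 2 ≤
        (γ i * slack (x i) (y i) e.1 ^ 2 + e.2.2 i ^ 2) * (1 - e.2.1 i)}
  have hS (w z b) : (w, z, b) ∈ S ↔ z ∈ box n ∧ ∀ i, γ i ≠ 0 →
      Compat (slack (x i) (y i) w) (z i) ∧
      γ i * (realPersp (slack (x i) (y i) w) (z i) - slack (x i) (y i) w ^ 2) ≤ b i ^ 2 := by
    simp only [S, Set.mem_ofPred_eq, Set.mem_univ, true_and]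
    refine and_congr_right fun hz => forall_congr' fun i => ?_
    rcases (hγ i).eq_or_lt with h | h
    · simp only [← h, ne_eq, not_true_eq_false, false_imp_iff, iff_true, zero_mul, zero_add]
      exact ⟨mul_nonneg (sq_nonneg _) (hz i).1, mul_nonneg (sq_nonneg _) (by linarith [(hz i).2])⟩
    · have e (r : ℝ) : (γ i * slack (x i) (y i) w ^ 2 + b i ^ 2) * r =
          γ i * ((slack (x i) (y i) w ^ 2 + b i ^ 2 / γ i) * r) := by
        field_simp
      rw [e, e, mul_le_mul_iff_right₀ h, mul_le_mul_iff_right₀ h,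
        ← compat_and_realPersp_le_iff (hz i) (by positivity)]
      simp only [ne_eq, h.ne', not_false_eq_true, true_imp_iff]
      rw [← sub_le_iff_le_add', le_div_iff₀ h, mul_comm]
  have hne : ((0 : Fin p → ℝ), (1 : Fin n → ℝ), (0 : Fin n → ℝ)) ∈ S := by
    refine (hS _ _ _).2 ⟨one_mem_box n, fun i _ => ?_⟩
    simp [Compat, slack, realPersp]
  obtain ⟨w, z, b, hm, hmin⟩ := exists_min_of_cone x y hlam γ (q := fun i b => b i ^ 2)
    (fun i => by fun_prop) isClosed_univ (S := S) (fun _ _ _ => Iff.rfl) ⟨_, hne⟩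
  obtain ⟨hz, hm'⟩ := (hS _ _ _).1 hm
  refine ⟨w, z, hz, fun w' z' hz' => ?_⟩
  by_cases hc : ∀ i, γ i ≠ 0 → Compat (slack (x i) (y i) w') (z' i)
  · rw [objective_eq_coe hc, objective_eq_coe fun i hi => (hm' i hi).1, EReal.coe_le_coe_iff]
    have hpos (i) : 0 ≤ γ i * (realPersp (slack (x i) (y i) w') (z' i) -
        slack (x i) (y i) w' ^ 2) := by
      by_cases hi : γ i = 0
      · simp [hi]
      · exact mul_nonneg (hγ i) (sub_nonneg.2 ((hc i hi).sq_le (hz' i)))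
    have h := hmin w' z' (fun i => √(γ i * (realPersp (slack (x i) (y i) w') (z' i) -
        slack (x i) (y i) w' ^ 2))) ((hS _ _ _).2 ⟨hz', fun i hi => ⟨hc i hi, by
          rw [Real.sq_sqrt (hpos i)]⟩⟩)
    simp_rw [fun i => Real.sq_sqrt (hpos i)] at h
    refine le_trans ?_ h
    unfold realObjective
    gcongr with i
    by_cases hi : γ i = 0
    · simp [hi, sq_nonneg]
    · exact (hm' i hi).2
  · push Not at hc
    obtain ⟨i, hi, hc⟩ := hc
    rw [objective_eq_top hγ hz' hi hc]
    exact le_top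

/-! ### Strong duality -/

theorem slack_of_eq_zero {p : ℕ} {x : Fin p → ℝ} (hx : x = 0) (y : ℝ) (w : Fin p → ℝ) :
    slack x y w = 1 := by simp [slack, hx]

theorem realPersp_one (z : ℝ) : realPersp 1 z = 1 / z := by
  simp [realPersp]

theorem slack_convexComb {p : ℕ} (x : Fin p → ℝ) (y : ℝ) (w w' : Fin p → ℝ) {a b : ℝ}
    (h : a + b = 1) : slack x y (a • w + b • w') = a * slack x y w + b * slack x y w' := by
  simp only [slack, dotProduct_add, dotProduct_smul, smul_eq_mul]
  linear_combination -h

theorem posSemidef_sub_vecMulVec_convexComb {p : ℕ} {w w' : Fin p → ℝ}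
    {W W' : Matrix (Fin p) (Fin p) ℝ} (h : (W - vecMulVec w w).PosSemidef)
    (h' : (W' - vecMulVec w' w').PosSemidef) {a b : ℝ} (ha : 0 ≤ a) (hb : 0 ≤ b)
    (hab : a + b = 1) :
    ((a • W + b • W') - vecMulVec (a • w + b • w') (a • w + b • w')).PosSemidef := by
  rw [← posSemidef_fromBlocks_iff] at h h' ⊢
  convert (h.smul ha).add (h'.smul hb) using 1
  rw [fromBlocks_smul, fromBlocks_smul, fromBlocks_add, ← add_smul, hab, one_smul]
  rfl

theorem quadratic_rank_one {p : ℕ} {x : Fin p → ℝ} {y : ℝ} (hy : y = 1 ∨ y = -1)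
    (w : Fin p → ℝ) (V : Matrix (Fin p) (Fin p) ℝ) :
    x ⬝ᵥ (vecMulVec w w + V) *ᵥ x - 2 * y * (x ⬝ᵥ w) + 1 = slack x y w ^ 2 + x ⬝ᵥ V *ᵥ x := by
  rw [add_mulVec, dotProduct_add, dotProduct_vecMulVec_mulVec, slack]
  have : y ^ 2 = 1 := by rcases hy with h | h <;> simp [h]
  linear_combination (-(x ⬝ᵥ w) ^ 2) * this

/-- Strong duality for the semidefinite program restricted to a convex set `C` of pairs `(w, z)`
with finite perspective terms. For `x i = 0` the slack is `1` and the constraint `1 / z i ≤ 1` has no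
Slater point, so `C` is asked to satisfy it and the value of `γ i` is free. -/
theorem exists_multipliers_on {n p : ℕ} (x : Fin n → Fin p → ℝ) {y : Fin n → ℝ}
    (hy : ∀ i, y i = 1 ∨ y i = -1) {lam : ℝ} (hlam : 0 ≤ lam)
    {C : Set ((Fin p → ℝ) × (Fin n → ℝ))} (hC : Convex ℝ C) (hne : C.Nonempty)
    (hbox : ∀ w z, (w, z) ∈ C → z ∈ box n)
    (hcompat : ∀ w z, (w, z) ∈ C → ∀ i, Compat (slack (x i) (y i) w) (z i))
    (hone : ∀ w z, (w, z) ∈ C → ∀ i, x i = 0 → z i = 1) {v : ℝ}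
    (hv : ∀ w z W, (w, z) ∈ C → SDPFeasible x y w z W → v ≤ sdpObjective lam z W) :
    ∃ γ ∈ multipliers x, (∀ i, x i = 0 → γ i = lam) ∧
      ∀ w z, (w, z) ∈ C → v ≤ realObjective x y lam γ w z := by
  classical
  -- Points `(w, z, r, W)`, with `r` an epigraph variable for the perspective terms.
  let K : Set ((Fin p → ℝ) × (Fin n → ℝ) × (Fin n → ℝ) × Matrix (Fin p) (Fin p) ℝ) :=
    {e | (e.1, e.2.1) ∈ C ∧ (e.2.2.2 - vecMulVec e.1 e.1).PosSemidef ∧ ∀ i, 0 ≤ e.2.2.1 i ∧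
      (slack (x i) (y i) e.1)⁺ ^ 2 ≤ e.2.2.1 i * e.2.1 i ∧
      (slack (x i) (y i) e.1)⁻ ^ 2 ≤ e.2.2.1 i * (1 - e.2.1 i)}
  let f (e : (Fin p → ℝ) × (Fin n → ℝ) × (Fin n → ℝ) × Matrix (Fin p) (Fin p) ℝ) : ℝ :=
    e.2.2.2.trace + lam * ∑ i, e.2.1 i
  -- The constraint of a vanishing `x i` reads `z i = 1`; it is part of `C`, and `-1` stands in.
  let g (i) (e : (Fin p → ℝ) × (Fin n → ℝ) × (Fin n → ℝ) × Matrix (Fin p) (Fin p) ℝ) : ℝ :=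
    if x i = 0 then -1 else
      e.2.2.1 i - (x i ⬝ᵥ e.2.2.2 *ᵥ x i - 2 * y i * (x i ⬝ᵥ e.1) + 1)
  have hK : Convex ℝ K := by
    rintro ⟨w, z, r, W⟩ ⟨h1, h2, h3⟩ ⟨w', z', r', W'⟩ ⟨h1', h2', h3'⟩ a b ha hb hab
    refine ⟨hC h1 h1' ha hb hab, posSemidef_sub_vecMulVec_convexComb h2 h2' ha hb hab,
      fun i => ⟨add_nonneg (mul_nonneg ha (h3 i).1) (mul_nonneg hb (h3' i).1), ?_⟩⟩
    have := cone_convex ha hb hab (h3 i).1 (h3' i).1 (hbox _ _ h1 i) (hbox _ _ h1' i)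
      (h3 i).2 (h3' i).2
    rw [← slack_convexComb _ _ _ _ hab] at this
    exact this
  have hf : ConvexOn ℝ K f := by
    refine ⟨hK, fun e _ e' _ a b _ _ _ => le_of_eq ?_⟩
    simp only [f, Prod.fst_add, Prod.snd_add, Prod.smul_fst, Prod.smul_snd, trace_add, trace_smul,
      Pi.add_apply, Pi.smul_apply, smul_eq_mul, Finset.sum_add_distrib, ← Finset.mul_sum]
    ring
  have hg (i) : ConvexOn ℝ K (g i) := by
    refine ⟨hK, fun e _ e' _ a b _ _ hab => le_of_eq ?_⟩
    by_cases hx : x i = 0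
    · simp only [g, if_pos hx, smul_eq_mul]
      linear_combination hab
    · simp only [g, if_neg hx, Prod.fst_add, Prod.snd_add, Prod.smul_fst, Prod.smul_snd,
        Pi.add_apply, Pi.smul_apply, smul_eq_mul, add_mulVec, smul_mulVec, dotProduct_add,
        dotProduct_smul]
      linear_combination hab
  have hmem {w z V} (hwz : (w, z) ∈ C) (hV : V.PosSemidef) :
      (w, z, fun i => realPersp (slack (x i) (y i) w) (z i), vecMulVec w w + V) ∈ K :=
    ⟨hwz, by simpa using hV, fun i => ⟨realPersp_nonneg (hbox _ _ hwz i),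
      (hcompat _ _ hwz i).cone (hbox _ _ hwz i)⟩⟩
  have hgmem {w z V} (i) (hx : x i ≠ 0) :
      g i (w, z, fun i => realPersp (slack (x i) (y i) w) (z i), vecMulVec w w + V) =
        realPersp (slack (x i) (y i) w) (z i) - slack (x i) (y i) w ^ 2 - x i ⬝ᵥ V *ᵥ x i := by
    simp only [g, if_neg hx, quadratic_rank_one (hy i)]
    ring
  have hxpos {i} (hx : x i ≠ 0) : 0 < x i ⬝ᵥ x i :=
    (Finset.sum_nonneg fun j _ => mul_self_nonneg _).lt_of_ne'
      fun h => hx (dotProduct_self_eq_zero.1 h)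
  obtain ⟨⟨w₀, z₀⟩, h₀⟩ := hne
  obtain ⟨M, hM⟩ := (Set.finite_range fun i =>
    (realPersp (slack (x i) (y i) w₀) (z₀ i) - slack (x i) (y i) w₀ ^ 2) /
      (x i ⬝ᵥ x i)).bddAbove
  have hpos : 0 ≤ |M| + 1 := by positivity
  have hslater (i) : g i (w₀, z₀, fun i => realPersp (slack (x i) (y i) w₀) (z₀ i),
      vecMulVec w₀ w₀ + (|M| + 1) • (1 : Matrix (Fin p) (Fin p) ℝ)) < 0 := by
    by_cases hx : x i = 0
    · simp [g, hx]
    · rw [hgmem i hx, smul_mulVec, one_mulVec, dotProduct_smul, smul_eq_mul, sub_neg,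
        ← div_lt_iff₀ (hxpos hx)]
      linarith [hM ⟨i, rfl⟩, le_abs_self M]
  have hvf (e) (he : e ∈ K) (hge : ∀ i, g i e ≤ 0) : v ≤ f e := by
    obtain ⟨w, z, r, W⟩ := e
    obtain ⟨h1, h2, h3⟩ := he
    refine hv w z W h1 ((SDPFeasible_iff hy).2 ⟨hbox _ _ h1, h2, fun i => ⟨hcompat _ _ h1 i, ?_⟩⟩)
    have hq : 0 ≤ x i ⬝ᵥ (W - vecMulVec w w) *ᵥ x i := by
      simpa using h2.dotProduct_mulVec_nonneg (x i)
    by_cases hx : x i = 0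
    · rw [slack_of_eq_zero hx, show z i = 1 from hone _ _ h1 i hx, realPersp_one]
      linarith
    · have := hge i
      simp only [g, if_neg hx] at this
      have e2 := quadratic_rank_one (x := x i) (hy i) w (W - vecMulVec w w)
      rw [add_sub_cancel] at e2
      have := ((compat_and_realPersp_le_iff (hbox _ _ h1 i) (h3 i).1).2 (h3 i).2).2
      linarith
  obtain ⟨γ, hγ, hlag⟩ := exists_lagrange_multipliers hf hg
    (hmem h₀ (PosSemidef.one.smul hpos)) hslater hvf
  let γ' : Fin n → ℝ := fun i => if x i = 0 then lam else γ i
  -- The rank-one direction `t • u uᵀ` shows that `γ'` is admissible; `t = 0` gives the bound.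
  have key {w z} (hwz : (w, z) ∈ C) (u : Fin p → ℝ) {t : ℝ} (ht : 0 ≤ t) :
      v ≤ realObjective x y lam γ' w z + (u ⬝ᵥ u - ∑ i, γ' i * (x i ⬝ᵥ u) ^ 2) * t := by
    have hV : (t • vecMulVec u u).PosSemidef := by
      have := posSemidef_vecMulVec_self_star u
      rw [star_trivial] at this
      exact this.smul ht
    refine (hlag _ (hmem hwz hV)).trans ?_
    have h1 : ∑ i, γ i * g i (w, z, fun i => realPersp (slack (x i) (y i) w) (z i),
        vecMulVec w w + t • vecMulVec u u) ≤
        ∑ i, (γ' i * (realPersp (slack (x i) (y i) w) (z i) - slack (x i) (y i) w ^ 2) -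
          γ' i * (x i ⬝ᵥ u) ^ 2 * t) := by
      refine Finset.sum_le_sum fun i _ => ?_
      by_cases hx : x i = 0
      · rw [slack_of_eq_zero hx, hone _ _ hwz i hx, realPersp_one]
        simp [g, hx, hγ i]
      · rw [hgmem i hx, smul_mulVec, dotProduct_smul, dotProduct_vecMulVec_mulVec]
        simp only [γ', if_neg hx, smul_eq_mul]
        exact le_of_eq (by ring)
    rw [Finset.sum_sub_distrib, ← Finset.sum_mul] at h1
    have h2 : (u ⬝ᵥ u) = (vecMulVec u u).trace := by simp [dotProduct, trace, vecMulVec_apply]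
    simp only [f, realObjective, trace_add, trace_smul, trace_vecMulVec_self, ← h2, smul_eq_mul]
    linarith
  refine ⟨γ', mem_multipliers_iff.2 ⟨fun i => ?_, fun u => ?_⟩, fun i hx => if_pos hx,
    fun w z hwz => ?_⟩
  · by_cases hx : x i = 0
    · simpa [γ', hx] using hlam
    · simpa [γ', hx] using hγ i
  · exact sub_nonneg.1 (nonneg_of_forall_le_add_mul fun t ht => key h₀ u ht)
  · simpa using key hwz 0 le_rfl

/-- Strong duality for the whole semidefinite program. Compared with `exists_multipliers_on`, the
bound is extended to pairs with an infinite perspective term at some `i` with `γ i = 0`, and to pairs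
with `z i ≠ 1` at some `i` with `x i = 0`. -/
theorem exists_multipliers {n p : ℕ} (x : Fin n → Fin p → ℝ) {y : Fin n → ℝ}
    (hy : ∀ i, y i = 1 ∨ y i = -1) {lam : ℝ} (hlam : 0 < lam) {v : ℝ}
    (hv : ∀ w z W, SDPFeasible x y w z W → v ≤ sdpObjective lam z W) :
    ∃ γ ∈ multipliers x, ∀ w, ∀ z ∈ box n, (v : EReal) ≤ objective x y lam γ w z := by
  classical
  let C : Set ((Fin p → ℝ) × (Fin n → ℝ)) :=
    {e | e.2 ∈ box n ∧ (∀ i, Compat (slack (x i) (y i) e.1) (e.2 i)) ∧ ∀ i, x i = 0 → e.2 i = 1}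
  have hC : Convex ℝ C := by
    rintro ⟨w, z⟩ ⟨h1, h2, h3⟩ ⟨w', z'⟩ ⟨h1', h2', h3'⟩ a b ha hb hab
    have hb1 (i) : 0 ≤ a * z i + b * z' i ∧ a * z i + b * z' i ≤ 1 :=
      ⟨add_nonneg (mul_nonneg ha (h1 i).1) (mul_nonneg hb (h1' i).1), by
        nlinarith [mul_le_mul_of_nonneg_left (h1 i).2 ha,
          mul_le_mul_of_nonneg_left (h1' i).2 hb]⟩
    refine ⟨hb1, fun i => ?_, fun i hx => ?_⟩
    · have := cone_convex ha hb hab (realPersp_nonneg (h1 i)) (realPersp_nonneg (h1' i)) (h1 i)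
        (h1' i) ((h2 i).cone (h1 i)) ((h2' i).cone (h1' i))
      rw [← slack_convexComb _ _ _ _ hab] at this
      exact ((compat_and_realPersp_le_iff (hb1 i) (add_nonneg
        (mul_nonneg ha (realPersp_nonneg (h1 i))) (mul_nonneg hb (realPersp_nonneg (h1' i))))).2
          this).1
    · change a * z i + b * z' i = 1
      have e1 := h3 i hx
      have e2 := h3' i hx
      simp only at e1 e2
      rw [e1, e2]; linarith
  obtain ⟨γ, hγ, hγ0, hle⟩ := exists_multipliers_on x hy hlam.le hC
    ⟨(0, 1), one_mem_box n, fun i => by simp [Compat, slack], fun i _ => rfl⟩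
    (fun _ _ h => h.1) (fun _ _ h => h.2.1) (fun _ _ h => h.2.2)
    (fun w z W _ h => hv w z W h)
  refine ⟨γ, hγ, fun w z hz => ?_⟩
  by_cases hc : ∀ i, γ i ≠ 0 → Compat (slack (x i) (y i) w) (z i)
  swap
  · push Not at hc
    obtain ⟨i, hi, hc⟩ := hc
    rw [objective_eq_top hγ.1 hz hi hc]
    exact le_top
  rw [objective_eq_coe hc, EReal.coe_le_coe_iff]
  -- Move `z` into `C`, raising the objective by at most `lam * n * ε`.
  have hε (ε : ℝ) (h0 : 0 < ε) (h1 : ε < 1) : v ≤ realObjective x y lam γ w z + n * (lam * ε) := by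
    -- At `x i = 0` the term `lam * (z i + 1 / z i - 1)` is least for `z i = 1`.
    let z' : Fin n → ℝ := fun i => if x i = 0 then 1 else if γ i = 0 then ε else z i
    have hz' : (w, z') ∈ C := by
      refine ⟨fun i => ?_, fun i => ?_, fun i hx => by simp [z', hx]⟩
      · simp only [z']
        split_ifs
        exacts [⟨zero_le_one, le_rfl⟩, ⟨h0.le, h1.le⟩, hz i]
      · simp only [z']
        split_ifs with hx hi
        · simp [Compat, slack_of_eq_zero hx]
        · exact compat_of_mem_Ioo ⟨h0, h1⟩
        · exact hc i hi
    refine (hle w z' hz').trans ?_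
    have hterm (i) : lam * z' i +
        γ i * (realPersp (slack (x i) (y i) w) (z' i) - slack (x i) (y i) w ^ 2) ≤
        lam * z i + γ i * (realPersp (slack (x i) (y i) w) (z i) - slack (x i) (y i) w ^ 2) +
          lam * ε := by
      simp only [z']
      have hl : 0 ≤ lam * ε := by positivity
      split_ifs with hx hi
      · have h2 := hc i (by rw [hγ0 i hx]; exact hlam.ne')
        rw [slack_of_eq_zero hx] at h2 ⊢
        have hzi : 0 < z i := (hz i).1.lt_of_ne' fun h => by linarith [h2.1 h]
        have hamgm : 2 ≤ z i + 1 / z i := by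
          have : z i + 1 / z i - 2 = (z i - 1) ^ 2 / z i := by field_simp; ring
          have : 0 ≤ (z i - 1) ^ 2 / z i := by positivity
          linarith
        rw [realPersp_one, realPersp_one, hγ0 i hx]
        nlinarith [mul_le_mul_of_nonneg_left hamgm hlam.le]
      · rw [hi]
        nlinarith [mul_nonneg hlam.le (hz i).1]
      · linarith
    have := Finset.sum_le_sum fun i (_ : i ∈ Finset.univ) => hterm i
    simp only [Finset.sum_add_distrib, ← Finset.mul_sum, Finset.sum_const, Finset.card_univ,
      Fintype.card_fin, nsmul_eq_mul] at this
    unfold realObjective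
    linarith
  refine le_of_forall_pos_le_add fun δ hδ => ?_
  have hA : 0 < n * lam + 1 := by positivity
  have h1 := hε (min (1 / 2) (δ / (n * lam + 1))) (by positivity)
    ((min_le_left _ _).trans_lt (by norm_num))
  have h2 : n * (lam * min (1 / 2) (δ / (n * lam + 1))) ≤ δ := by
    calc _ = (n * lam) * min (1 / 2) (δ / (n * lam + 1)) := by ring
      _ ≤ (n * lam + 1) * (δ / (n * lam + 1)) := by
        gcongr
        · linarith
        · exact min_le_right _ _
      _ = δ := by field_simp
  linarith

/-! ### Saddle points -/

/-- Small multiples of each coordinate vector are admissible multipliers, so a pair on which the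
objective is bounded over all multipliers has finite perspective terms. -/
theorem compat_of_forall_objective_le {n p : ℕ} {x : Fin n → Fin p → ℝ} {y : Fin n → ℝ}
    {lam : ℝ} {w : Fin p → ℝ} {z : Fin n → ℝ} (hz : z ∈ box n) {M : ℝ}
    (h : ∀ γ ∈ multipliers x, objective x y lam γ w z ≤ (M : EReal)) (i : Fin n) :
    Compat (slack (x i) (y i) w) (z i) := by
  by_contra hc
  have hq : 0 ≤ x i ⬝ᵥ x i := Finset.sum_nonneg fun j _ => mul_self_nonneg _
  have hm := smul_single_mem_multipliers x i (t := 1 / (x i ⬝ᵥ x i + 1)) (by positivity) (by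
    rw [div_mul_eq_mul_div, one_mul]
    exact (div_le_one (by positivity)).2 (by linarith))
  have := h _ hm
  rw [objective_eq_top hm.1 hz (i := i) (by simp; positivity) hc] at this
  exact (EReal.coe_ne_top M) (top_le_iff.1 this)

/-- If `x i = 0`, the multiplier `γ i` is unbounded, so its coefficient `1 / z i - 1`
must vanish. -/
theorem eq_one_of_forall_objective_le {n p : ℕ} {x : Fin n → Fin p → ℝ} {y : Fin n → ℝ}
    {lam : ℝ} {w : Fin p → ℝ} {z : Fin n → ℝ} (hz : z ∈ box n) {M : ℝ}
    (h : ∀ γ ∈ multipliers x, objective x y lam γ w z ≤ (M : EReal)) {i : Fin n}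
    (hx : x i = 0) : z i = 1 := by
  have hc := compat_of_forall_objective_le hz h
  have hi := hc i
  rw [slack_of_eq_zero hx] at hi
  have hzi : 0 < z i := (hz i).1.lt_of_ne' fun h => by linarith [hi.1 h]
  have h1 : 0 ≤ -(realPersp (slack (x i) (y i) w) (z i) - slack (x i) (y i) w ^ 2) := by
    refine nonneg_of_forall_le_add_mul (k := ∑ j, w j ^ 2 + lam * ∑ i, z i) (a := M)
      fun t ht => ?_
    have h2 := h _ (smul_single_mem_multipliers x i ht (by simp [hx]))
    rw [objective_eq_coe fun j _ => hc j, EReal.coe_le_coe_iff, realObjective,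
      Fintype.sum_eq_single (a := i)
        (f := fun j => Pi.single (M := fun _ => ℝ) i t j *
          (realPersp (slack (x j) (y j) w) (z j) - slack (x j) (y j) w ^ 2))
        (fun j hj => by simp [hj]), Pi.single_eq_same] at h2
    linarith
  rw [slack_of_eq_zero hx, realPersp_one] at h1
  have h2 : 1 / z i ≤ 1 := by linarith
  rw [div_le_one hzi] at h2
  exact le_antisymm (hz i).2 h2

theorem le_innerValue_iff {n p : ℕ} {x : Fin n → Fin p → ℝ} {y : Fin n → ℝ} {lam : ℝ}
    {γ : Fin n → ℝ} {v : EReal} : v ≤ innerValue x y lam γ ↔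
      ∀ w, ∀ z ∈ box n, v ≤ objective x y lam γ w z := by
  simp only [innerValue, le_iInf_iff]

theorem innerValue_le {n p : ℕ} (x : Fin n → Fin p → ℝ) (y : Fin n → ℝ) (lam : ℝ)
    (γ : Fin n → ℝ) (w : Fin p → ℝ) {z : Fin n → ℝ} (hz : z ∈ box n) :
    innerValue x y lam γ ≤ objective x y lam γ w z :=
  le_innerValue_iff.1 le_rfl w z hz

theorem IsInnerMin.innerValue_eq {n p : ℕ} {x : Fin n → Fin p → ℝ} {y : Fin n → ℝ} {lam : ℝ}
    {γ : Fin n → ℝ} {w : Fin p → ℝ} {z : Fin n → ℝ} (h : IsInnerMin x y lam γ w z) :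
    innerValue x y lam γ = objective x y lam γ w z :=
  le_antisymm (innerValue_le x y lam γ w h.1) (le_innerValue_iff.2 h.2)

theorem sdpValue_eq {n p : ℕ} {x : Fin n → Fin p → ℝ} {y : Fin n → ℝ} {lam : ℝ}
    {w : Fin p → ℝ} {z : Fin n → ℝ} {W : Matrix (Fin p) (Fin p) ℝ}
    (h : IsSDPMin x y lam w z W) : sdpValue x y lam = (sdpObjective lam z W : EReal) := by
  refine le_antisymm ?_ ?_
  · exact iInf_le_of_le w (iInf_le_of_le z (iInf_le_of_le W (iInf_le_of_le h.1 le_rfl)))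
  · simp only [sdpValue, le_iInf_iff]
    exact fun w' z' W' h' => EReal.coe_le_coe_iff.2 (h.2 w' z' W' h')

/-- Strong duality for a fixed pair `(w, z)`, where the supremum over `γ` of the objective is the
least value of the semidefinite program over `W`. -/
theorem exists_sdp_min_of_forall_objective_le {n p : ℕ} {x : Fin n → Fin p → ℝ} {y : Fin n → ℝ}
    (hy : ∀ i, y i = 1 ∨ y i = -1) {lam : ℝ} (hlam : 0 ≤ lam) {w : Fin p → ℝ}
    {z : Fin n → ℝ} (hz : z ∈ box n) {M : ℝ}
    (h : ∀ γ ∈ multipliers x, objective x y lam γ w z ≤ (M : EReal)) :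
    ∃ W, SDPFeasible x y w z W ∧ sdpObjective lam z W ≤ M := by
  have hc := compat_of_forall_objective_le hz h
  have hmul {v : ℝ} (hv : ∀ W, SDPFeasible x y w z W → v ≤ sdpObjective lam z W) : v ≤ M := by
    obtain ⟨γ, hγ, -, hle⟩ := exists_multipliers_on x hy hlam (convex_singleton (w, z))
      (Set.singleton_nonempty _) (v := v) (by rintro _ _ ⟨⟩; exact hz)
      (by rintro _ _ ⟨⟩; exact hc)
      (by rintro _ _ ⟨⟩ i hx; exact eq_one_of_forall_objective_le hz h hx)
      (by rintro _ _ W ⟨⟩ hf; exact hv W hf)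
    have := h γ hγ
    rw [objective_eq_coe fun i _ => hc i, EReal.coe_le_coe_iff] at this
    exact (hle w z rfl).trans this
  -- If no `W` were feasible, every `v` would be a lower bound.
  have hne : ∃ W, SDPFeasible x y w z W := by
    by_contra hne
    push Not at hne
    linarith [hmul (v := M + 1) fun W hf => absurd hf (hne W)]
  obtain ⟨W₀, h₀⟩ := hne
  obtain ⟨w', z', W, ⟨⟩, hf, hmin⟩ := exists_sdp_min_on x hy hlam (isClosed_singleton (x := (w, z)))
    ⟨w, z, W₀, rfl, h₀⟩
  exact ⟨W, hf, hmul fun W' hf' => hmin w z W' rfl hf'⟩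

theorem exists_isSDPMin {n p : ℕ} (x : Fin n → Fin p → ℝ) {y : Fin n → ℝ}
    (hy : ∀ i, y i = 1 ∨ y i = -1) {lam : ℝ} (hlam : 0 ≤ lam) :
    ∃ w z W, IsSDPMin x y lam w z W := by
  have h₀ : SDPFeasible x y 0 1 0 := by
    refine (SDPFeasible_iff hy).2 ⟨one_mem_box n, ?_, fun i => ?_⟩
    · simpa using PosSemidef.zero
    · simp [Compat, slack, realPersp]
  obtain ⟨w, z, W, -, hf, hmin⟩ := exists_sdp_min_on x hy hlam isClosed_univ
    ⟨0, 1, 0, Set.mem_univ _, h₀⟩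
  exact ⟨w, z, W, hf, fun w' z' W' => hmin w' z' W' (Set.mem_univ _)⟩

end ConicSVM

open ConicSVM in
theorem theorem2 {n p : ℕ} (x : Fin n → Fin p → ℝ) (y : Fin n → ℝ) (lam : ℝ)
    (hy : ∀ i, y i = 1 ∨ y i = -1) (hlam : 0 < lam) :
    (∀ γ ∈ ConicSVM.multipliers x, ∃ w z, ConicSVM.IsInnerMin x y lam γ w z) ∧
    (∃ γ, ConicSVM.IsOuterMax x y lam γ) ∧
    (∃ w z W, ConicSVM.IsSDPMin x y lam w z W) ∧
    ConicSVM.maxMinValue x y lam = ConicSVM.sdpValue x y lam ∧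
    (∀ γ w z, ConicSVM.IsSaddle x y lam γ w z ↔
      ConicSVM.IsOuterMax x y lam γ ∧ ∃ W, ConicSVM.IsSDPMin x y lam w z W) := by
  obtain ⟨w₀, z₀, W₀, h₀⟩ := exists_isSDPMin x hy hlam.le
  obtain ⟨γ₀, hγ₀, hle₀⟩ := exists_multipliers x hy hlam h₀.2
  have hlow : (sdpObjective lam z₀ W₀ : EReal) ≤ innerValue x y lam γ₀ := le_innerValue_iff.2 hle₀
  have hup {γ} (hγ : γ ∈ multipliers x) : innerValue x y lam γ ≤ (sdpObjective lam z₀ W₀ : EReal) :=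
    (innerValue_le x y lam γ w₀ h₀.1.2.2).trans (objective_le_sdpObjective hy lam hγ h₀.1)
  have hmax {γ} (h : IsOuterMax x y lam γ) :
      innerValue x y lam γ = (sdpObjective lam z₀ W₀ : EReal) :=
    le_antisymm (hup h.1) (hlow.trans (h.2 γ₀ hγ₀))
  refine ⟨fun γ hγ => exists_isInnerMin x y hlam.le hγ.1,
    ⟨γ₀, hγ₀, fun γ hγ => (hup hγ).trans hlow⟩, ⟨w₀, z₀, W₀, h₀⟩, ?_, fun γ w z => ⟨?_, ?_⟩⟩
  · rw [sdpValue_eq h₀]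
    exact le_antisymm (iSup₂_le fun γ hγ => hup hγ) (hlow.trans (le_iSup₂_of_le γ₀ hγ₀ le_rfl))
  · rintro ⟨hγ, hin, hout⟩
    have hopt : IsOuterMax x y lam γ := ⟨hγ, fun γ' hγ' =>
      (innerValue_le x y lam γ' w hin.1).trans ((hout γ' hγ').trans hin.innerValue_eq.ge)⟩
    have hval := hin.innerValue_eq.symm.trans (hmax hopt)
    obtain ⟨W, hf, hW⟩ := exists_sdp_min_of_forall_objective_le hy hlam.le hin.1
      fun γ' hγ' => (hout γ' hγ').trans hval.le
    exact ⟨hopt, W, hf, fun w' z' W' h' => hW.trans (h₀.2 w' z' W' h')⟩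
  · rintro ⟨hopt, W, hW⟩
    have hval : (sdpObjective lam z W : EReal) = innerValue x y lam γ := by
      rw [hmax hopt, ← sdpValue_eq hW, ← sdpValue_eq h₀]
    have hle {γ'} (hγ' : γ' ∈ multipliers x) :
        objective x y lam γ' w z ≤ innerValue x y lam γ :=
      (objective_le_sdpObjective hy lam hγ' hW.1).trans hval.le
    exact ⟨hopt.1, ⟨hW.1.2.2, fun w' z' hz' => (hle hopt.1).trans (innerValue_le x y lam γ w' hz')⟩,
      fun γ' hγ' => (hle hγ').trans (innerValue_le x y lam γ w hW.1.2.2)⟩
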